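/- Let $d\ge 0$, $k\ge 2$, and let $\mathcal F=\{f_1,\dots,f_k\}$ be a Euclidean iterated function system, i.e. each $f_i:\mathbb R^d\to\mathbb R^d$ is a similitude with $\|f_i(x)-f_i(y)\|=c_i\|x-y\|$ for all $x,y$, where $c_i\in(0,1)$. Let $K$ be its attractor, the unique nonempty compact set with $K=\bigcup_{i=1}^k f_i(K)$. For a word $\mathbf i=i_1\cdots i_n\in\{1,\dots,k\}^n$ put $f_{\mathbf i}=f_{i_1}\circ\cdots\circ f_{i_n}$. The natural fractal structure of $K$ is the sequence $\boldsymbol\Gamma=(\Gamma_n)_{n\ge1}$ of coverings $\Gamma_n=(f_{\mathbf i}(K))_{\mathbf i\in\{1,\dots,k\}^n}$ of $K$, regarded as families indexed by words (so a set may occur several times in a level). The order of $\boldsymbol\Gamma$ is $\operatorname{ord}(\boldsymbol\Gamma)=\sup_{n\ge1}\ \sup_{x\in K}\ \bigl(\#\{\mathbf i\in\{1,\dots,k\}^n: x\in f_{\mathbf i}(K)\}-1\bigr)$. We say that $\boldsymbol\Gamma$ is irreducible if no level has a proper subcovering: for every $n\ge1$ and every $J\subsetneq\{1,\dots,k\}^n$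 one has $\bigcup_{\mathbf j\in J}f_{\mathbf j}(K)\ne K$. The system satisfies the open set condition (OSC) if there is a nonempty open set $V\subseteq\mathbb R^d$ such that the sets $f_1(V),\dots,f_k(V)$ are pairwise disjoint and all contained in $V$. Then: (a) if $\mathcal F$ satisfies the OSC, then $\operatorname{ord}(\boldsymbol\Gamma)<\infty$; that is, every point of $K$ lies in a number of pieces of each level that is bounded uniformly in the point and the level. (b) If $\operatorname{ord}(\boldsymbol\Gamma)<\infty$, then $\boldsymbol\Gamma$ is irreducible. -/

import Mathlib

open Set TopologicalSpace

/-- An iterated function system: `k ≥ 2` contracting similitudes `f 1, …, f k` of a metric space,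
`f i` having similarity ratio `ratio i ∈ (0, 1)`. -/
structure IFS (X : Type*) [MetricSpace X] (k : ℕ) where
  two_le : 2 ≤ k
  f : Fin k → X → X
  ratio : Fin k → ℝ
  ratio_pos : ∀ i, 0 < ratio i
  ratio_lt_one : ∀ i, ratio i < 1
  dist_map : ∀ i x y, dist (f i x) (f i y) = ratio i * dist x y

namespace IFS

variable {X : Type*} [MetricSpace X] {k : ℕ}

/-- `K` is a nonempty compact solution of Hutchinson's equation `K = ⋃ i, f i (K)`. -/
def IsAttractor (F : IFS X k) (K : Set X) : Prop :=
  K.Nonempty ∧ IsCompact K ∧ K = ⋃ i, F.f i '' K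

theorem continuous_f (F : IFS X k) (i : Fin k) : Continuous (F.f i) :=
  (LipschitzWith.of_dist_le_mul (K := (F.ratio i).toNNReal) fun x y => by
    rw [F.dist_map, Real.coe_toNNReal _ (F.ratio_pos i).le]).continuous

/-- The Hutchinson operator on nonempty compact sets. -/
def hutchinson (F : IFS X k) (K : NonemptyCompacts X) : NonemptyCompacts X where
  carrier := ⋃ i, F.f i '' K
  isCompact' := isCompact_iUnion fun i => K.isCompact.image (F.continuous_f i)
  nonempty' := by
    obtain ⟨x, hx⟩ := K.nonempty
    exact ⟨F.f ⟨0, by have := F.two_le; omega⟩ x, mem_iUnion.2 ⟨_, x, hx, rfl⟩⟩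

theorem exists_ratio_bound (F : IFS X k) : ∃ c : NNReal, c < 1 ∧ ∀ i, F.ratio i ≤ c := by
  have : Nonempty (Fin k) := ⟨⟨0, by have := F.two_le; omega⟩⟩
  obtain ⟨i, hi⟩ := Finite.exists_max F.ratio
  exact ⟨⟨F.ratio i, (F.ratio_pos i).le⟩, F.ratio_lt_one i, hi⟩

theorem exists_contracting (F : IFS X k) : ∃ c : NNReal, ContractingWith c F.hutchinson := by
  obtain ⟨c, hc1, hc⟩ := F.exists_ratio_bound
  have key : ∀ A B : NonemptyCompacts X, ∀ x ∈ (F.hutchinson A : Set X),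
      ∃ y ∈ (F.hutchinson B : Set X), dist x y ≤ c * dist A B := by
    intro A B x hx
    obtain ⟨i, a, ha, rfl⟩ := mem_iUnion.1 hx
    obtain ⟨b, hb, hab⟩ := B.isCompact.exists_infDist_eq_dist B.nonempty a
    refine ⟨F.f i b, mem_iUnion.2 ⟨i, b, hb, rfl⟩, ?_⟩
    have h1 : dist a b ≤ dist A B := by
      rw [← hab, Metric.NonemptyCompacts.dist_eq]
      exact Metric.infDist_le_hausdorffDist_of_mem ha
        (Metric.hausdorffEDist_ne_top_of_nonempty_of_bounded A.nonempty B.nonempty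
          A.isCompact.isBounded B.isCompact.isBounded)
    rw [F.dist_map]
    exact mul_le_mul (hc i) h1 dist_nonneg c.2
  refine ⟨c, hc1, LipschitzWith.of_dist_le_mul fun A B => ?_⟩
  rw [Metric.NonemptyCompacts.dist_eq]
  refine Metric.hausdorffDist_le_of_mem_dist (mul_nonneg c.2 dist_nonneg) (key A B) ?_
  rw [dist_comm A B]
  exact key B A

/-- An IFS on a (nonempty) complete metric space has exactly one attractor. -/
theorem existsUnique_isAttractor [CompleteSpace X] [Nonempty X] (F : IFS X k) :
    ∃! K : Set X, F.IsAttractor K := by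
  obtain ⟨c, hF⟩ := F.exists_contracting
  refine ⟨(ContractingWith.fixedPoint F.hutchinson hF : NonemptyCompacts X), ?_, ?_⟩
  · refine ⟨NonemptyCompacts.nonempty _, NonemptyCompacts.isCompact _, ?_⟩
    exact congrArg (fun K : NonemptyCompacts X => (K : Set X))
      hF.fixedPoint_isFixedPt.symm
  · rintro K ⟨hne, hK, hEq⟩
    have : Function.IsFixedPt F.hutchinson ⟨⟨K, hK⟩, hne⟩ :=
      NonemptyCompacts.ext hEq.symm
    exact congrArg (fun K : NonemptyCompacts X => (K : Set X)) (hF.fixedPoint_unique this)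

/-- The attractor of an IFS: the unique nonempty compact `K` with `K = ⋃ i, f i (K)`. -/
noncomputable def attractor [CompleteSpace X] [Nonempty X] (F : IFS X k) : Set X :=
  F.existsUnique_isAttractor.choose

theorem attractor_spec [CompleteSpace X] [Nonempty X] (F : IFS X k) :
    F.IsAttractor F.attractor :=
  F.existsUnique_isAttractor.choose_spec.1

/-- `f_w = f_{w 1} ∘ ⋯ ∘ f_{w n}` for a word `w` over the alphabet `Fin k`. -/
def wordMap (F : IFS X k) : List (Fin k) → X → X
  | [] => id
  | i :: w => F.f i ∘ F.wordMap w

theorem wordMap_append (F : IFS X k) (v w : List (Fin k)) :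
    F.wordMap (v ++ w) = F.wordMap v ∘ F.wordMap w := by
  induction v with
  | nil => rfl
  | cons i v ih => simp [wordMap, ih, Function.comp_assoc]

/-- The open set condition (in the sense of Moran): there is a nonempty open set `V` whose images
`f i (V)` are pairwise disjoint and contained in `V`. -/
def OpenSetCondition (F : IFS X k) : Prop :=
  ∃ V : Set X, IsOpen V ∧ V.Nonempty ∧ (∀ i, F.f i '' V ⊆ V) ∧
    ∀ i j, i ≠ j → Disjoint (F.f i '' V) (F.f j '' V)

end IFS

/-- A fractal structure on the set `S`: a sequence of coverings of `S`, each one a strong refinement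
of the previous one. A level is an indexed family, so that a set may occur several times in it. -/
structure FractalStructure {X : Type*} (S : Set X) where
  Index : ℕ → Type
  piece : ∀ n, Index n → Set X
  covers : ∀ n, ⋃ i, piece n i = S
  refines : ∀ n (i : Index (n + 1)), ∃ j : Index n, piece (n + 1) i ⊆ piece n j
  refines_eq : ∀ n (j : Index n),
    piece n j = ⋃ i ∈ {i : Index (n + 1) | piece (n + 1) i ⊆ piece n j}, piece (n + 1) i

/-- The order of a covering `A` of `S` at the point `x`: the number of members that contain `x`
(counted with multiplicity), minus one. -/
noncomputable def coveringOrderAt {X ι : Type*} (A : ι → Set X) (x : X) : ℕ∞ :=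
  {i | x ∈ A i}.encard - 1

/-- The order of a covering `A` of `S`. -/
noncomputable def coveringOrder {X ι : Type*} (S : Set X) (A : ι → Set X) : ℕ∞ :=
  ⨆ x ∈ S, coveringOrderAt A x

/-- A covering `A` of `S` is irreducible if it has no proper subcovering. -/
def IsIrreducibleCovering {X ι : Type*} (S : Set X) (A : ι → Set X) : Prop :=
  ⋃ i, A i = S ∧ ∀ J : Set ι, ⋃ i ∈ J, A i = S → J = univ

namespace FractalStructure

variable {X : Type*} {S : Set X}

/-- The order of a fractal structure: the supremum of the orders of its levels. -/
noncomputable def order (Γ : FractalStructure S) : ℕ∞ :=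
  ⨆ n, coveringOrder S (Γ.piece n)

/-- A fractal structure is irreducible if all its levels are irreducible coverings. -/
def IsIrreducible (Γ : FractalStructure S) : Prop :=
  ∀ n, IsIrreducibleCovering S (Γ.piece n)

end FractalStructure

namespace IFS

variable {X : Type*} [MetricSpace X] [CompleteSpace X] [Nonempty X] {k : ℕ}

theorem image_wordMap_eq (F : IFS X k) (w : List (Fin k)) :
    F.wordMap w '' F.attractor = ⋃ i, F.wordMap (w ++ [i]) '' F.attractor := by
  conv_lhs => rw [F.attractor_spec.2.2, image_iUnion]
  simp only [wordMap_append, image_comp]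
  rfl

theorem iUnion_image_wordMap (F : IFS X k) (n : ℕ) :
    ⋃ w : {w : List (Fin k) // w.length = n}, F.wordMap w.1 '' F.attractor = F.attractor := by
  induction n with
  | zero =>
    ext x
    simp only [mem_iUnion]
    constructor
    · rintro ⟨⟨w, hw⟩, hx⟩
      obtain rfl := List.length_eq_zero_iff.1 hw
      simpa [wordMap] using hx
    · intro hx
      exact ⟨⟨[], rfl⟩, x, hx, rfl⟩
  | succ n ih =>
    refine Eq.trans ?_ ih
    ext x
    simp only [mem_iUnion]
    constructor
    · rintro ⟨⟨w, hw⟩, hx⟩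
      obtain ⟨v, i, rfl⟩ : ∃ v i, w = v ++ [i] :=
        ⟨w.dropLast, w.getLast (by rintro rfl; simp at hw),
          (List.dropLast_append_getLast _).symm⟩
      refine ⟨⟨v, by simpa using hw⟩, ?_⟩
      rw [image_wordMap_eq]
      exact mem_iUnion.2 ⟨i, hx⟩
    · rintro ⟨⟨v, hv⟩, hx⟩
      rw [image_wordMap_eq] at hx
      obtain ⟨i, hi⟩ := mem_iUnion.1 hx
      exact ⟨⟨v ++ [i], by simp [hv]⟩, hi⟩

/-- The natural fractal structure on the attractor `K` of an IFS: its levels are the families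
`f_w (K)`, indexed by the words `w` of length `1`, `2`, …; the component `n : ℕ` is the level of
the words of length `n + 1`. -/
noncomputable def naturalFractalStructure (F : IFS X k) : FractalStructure F.attractor where
  Index n := {w : List (Fin k) // w.length = n + 1}
  piece _ w := F.wordMap w.1 '' F.attractor
  covers n := F.iUnion_image_wordMap (n + 1)
  refines := by
    rintro n ⟨w, hw⟩
    obtain ⟨v, i, rfl⟩ : ∃ v i, w = v ++ [i] :=
      ⟨w.dropLast, w.getLast (by rintro rfl; simp at hw), (List.dropLast_append_getLast _).symm⟩
    refine ⟨⟨v, by simpa using hw⟩, ?_⟩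
    dsimp only
    rw [F.image_wordMap_eq v]
    exact subset_iUnion (fun i => F.wordMap (v ++ [i]) '' F.attractor) i
  refines_eq := by
    rintro n ⟨v, hv⟩
    refine Subset.antisymm ?_ (iUnion₂_subset fun _ h => h)
    dsimp only
    intro x hx
    rw [F.image_wordMap_eq v] at hx
    obtain ⟨i, hi⟩ := mem_iUnion.1 hx
    refine mem_iUnion₂.2 ⟨⟨v ++ [i], by simp [hv]⟩, ?_, hi⟩
    change F.wordMap (v ++ [i]) '' F.attractor ⊆ F.wordMap v '' F.attractor
    rw [F.image_wordMap_eq v]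
    exact subset_iUnion (fun i => F.wordMap (v ++ [i]) '' F.attractor) i

end IFS

/-! Finite order under the OSC is a packing argument. Fix a point `x` and a level, and let `r` be
the smallest ratio raised to the word length. Every piece of that level through `x` has ratio at
least `r`, so it can be refined around `x` to a piece of ratio between `c * r` and `r`
(`exists_extension_wordRatio`). The images of a fixed `v ∈ V` under these refined maps lie within `D
* r` of `x`. They are `c * ρ * r`-separated, because distinct words of equal length give disjoint
images of `V` and each refined image contains a ball of radius at least `c * ρ * r`.
`exists_encard_le_of_separated` bounds their number independently of `r`.

Irreducibility is by amplification (`exists_le_encard`). If the piece of `w` is redundant, applying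
`f_w` to a point of multiplicity at least `m` gives one of multiplicity at least `m + 1` at a deeper
level: the old words prefixed by `w`, and one word starting in the subcovering. Iterating
contradicts finite order. -/

namespace IFS

/-! ### Ratios and disjointness along words -/

section Words

variable {X : Type*} [MetricSpace X] {k : ℕ}

/-- The similarity ratio of `f_w`. -/
def wordRatio (F : IFS X k) (w : List (Fin k)) : ℝ := (w.map F.ratio).prod

theorem wordRatio_append (F : IFS X k) (v w : List (Fin k)) :
    F.wordRatio (v ++ w) = F.wordRatio v * F.wordRatio w := by
  simp [wordRatio]

theorem wordRatio_singleton (F : IFS X k) (i : Fin k) : F.wordRatio [i] = F.ratio i := by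
  simp [wordRatio]

theorem wordRatio_pos (F : IFS X k) (w : List (Fin k)) : 0 < F.wordRatio w := by
  refine List.prod_pos fun a ha => ?_
  obtain ⟨i, -, rfl⟩ := List.mem_map.1 ha
  exact F.ratio_pos i

theorem dist_wordMap (F : IFS X k) (w : List (Fin k)) (x y : X) :
    dist (F.wordMap w x) (F.wordMap w y) = F.wordRatio w * dist x y := by
  induction w with
  | nil => simp [wordMap, wordRatio]
  | cons i w ih =>
    have : F.wordRatio (i :: w) = F.ratio i * F.wordRatio w := by simp [wordRatio]
    simp only [wordMap, Function.comp_apply]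
    rw [F.dist_map, ih, this, mul_assoc]

theorem wordMap_injective (F : IFS X k) (w : List (Fin k)) : Function.Injective (F.wordMap w) := by
  intro x y h
  have := F.dist_wordMap w x y
  rw [h, dist_self, eq_comm, mul_eq_zero] at this
  exact dist_eq_zero.1 (this.resolve_left (F.wordRatio_pos w).ne')

theorem exists_ratio_lower_bound (F : IFS X k) : ∃ c : ℝ, 0 < c ∧ ∀ i, c ≤ F.ratio i := by
  have : Nonempty (Fin k) := ⟨⟨0, by have := F.two_le; omega⟩⟩
  obtain ⟨i, hi⟩ := Finite.exists_min F.ratio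
  exact ⟨F.ratio i, F.ratio_pos i, hi⟩

theorem pow_le_wordRatio (F : IFS X k) {c : ℝ} (hc0 : 0 ≤ c) (hc : ∀ i, c ≤ F.ratio i)
    (w : List (Fin k)) : c ^ w.length ≤ F.wordRatio w := by
  induction w with
  | nil => simp [wordRatio]
  | cons i w ih =>
    have : F.wordRatio (i :: w) = F.ratio i * F.wordRatio w := by simp [wordRatio]
    rw [this, List.length_cons, pow_succ']
    exact mul_le_mul (hc i) ih (pow_nonneg hc0 _) (F.ratio_pos i).le

theorem image_wordMap_subset (F : IFS X k) {V : Set X} (hV : ∀ i, F.f i '' V ⊆ V)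
    (w : List (Fin k)) : F.wordMap w '' V ⊆ V := by
  induction w with
  | nil => simp [wordMap]
  | cons i w ih =>
    rw [wordMap, image_comp]
    exact (image_mono ih).trans (hV i)

/-- Common first letters cancel by injectivity; at the first differing letter the two images sit
inside disjoint sets `f i (V)` and `f j (V)`. -/
theorem disjoint_image_wordMap (F : IFS X k) {V : Set X} (hV : ∀ i, F.f i '' V ⊆ V)
    (hd : ∀ i j, i ≠ j → Disjoint (F.f i '' V) (F.f j '' V)) {v w : List (Fin k)}
    (hl : v.length = w.length) (hne : v ≠ w) :
    Disjoint (F.wordMap v '' V) (F.wordMap w '' V) := by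
  induction v generalizing w with
  | nil => exact absurd (List.length_eq_zero_iff.1 hl.symm).symm hne
  | cons i v ih =>
    cases w with
    | nil => simp at hl
    | cons j w =>
      simp only [wordMap, image_comp]
      by_cases hij : i = j
      · subst hij
        have hinj : Function.Injective (F.f i) := F.wordMap_injective [i]
        exact (disjoint_image_iff hinj).2 (ih (by simpa using hl) (by simpa using hne))
      · exact (hd i j hij).mono (image_mono (F.image_wordMap_subset hV v))
          (image_mono (F.image_wordMap_subset hV w))

end Words

/-! ### Multiplicity of points and irreducibility -/

section Attractor

variable {X : Type*} [MetricSpace X] [CompleteSpace X] [Nonempty X] {k : ℕ}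

/-- A point of `f_w (K)` lies in a piece `f_(wu) (K)` whose ratio is comparable to a prescribed
`r`, not larger than the ratio of `f_w`. -/
theorem exists_extension_wordRatio (F : IFS X k) {c : ℝ} (hc : ∀ i, c ≤ F.ratio i) {r : ℝ}
    (hr : 0 < r) {x : X} {w : List (Fin k)} (hw : c * r ≤ F.wordRatio w)
    (hx : x ∈ F.wordMap w '' F.attractor) :
    ∃ u, x ∈ F.wordMap (w ++ u) '' F.attractor ∧
      c * r ≤ F.wordRatio (w ++ u) ∧ F.wordRatio (w ++ u) ≤ r := by
  obtain ⟨C, hC1, hC⟩ := F.exists_ratio_bound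
  -- Otherwise every admissible extension has ratio above `r`, so one more letter keeps it at least
  -- `c * r`; this never stops, yet the ratios decay geometrically.
  by_contra! hcon
  have key : ∀ m : ℕ, ∃ u, x ∈ F.wordMap (w ++ u) '' F.attractor ∧
      c * r ≤ F.wordRatio (w ++ u) ∧ F.wordRatio (w ++ u) ≤ F.wordRatio w * (C : ℝ) ^ m := by
    intro m
    induction m with
    | zero => exact ⟨[], by simpa using hx, by simpa using hw, by simp⟩
    | succ m ih =>
      obtain ⟨u, hxu, hu, hum⟩ := ih
      have hlt := hcon u hxu hu
      rw [F.image_wordMap_eq] at hxu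
      obtain ⟨i, hi⟩ := mem_iUnion.1 hxu
      refine ⟨u ++ [i], by rwa [← List.append_assoc], ?_, ?_⟩ <;>
        rw [← List.append_assoc, wordRatio_append, wordRatio_singleton]
      · rw [mul_comm c r]
        -- The sign of `c` is not assumed; for negative `c` the left side is nonpositive.
        by_cases h0 : 0 ≤ c
        · exact mul_le_mul hlt.le (hc i) h0 (F.wordRatio_pos _).le
        · exact (mul_nonpos_of_nonneg_of_nonpos hr.le (not_le.1 h0).le).trans
            (mul_pos (F.wordRatio_pos _) (F.ratio_pos i)).le
      · rw [pow_succ, ← mul_assoc]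
        exact mul_le_mul hum (hC i) (F.ratio_pos i).le
          (mul_nonneg (F.wordRatio_pos w).le (pow_nonneg C.2 m))
  have hlim : Filter.Tendsto (fun m : ℕ => F.wordRatio w * (C : ℝ) ^ m) Filter.atTop
      (nhds (F.wordRatio w * 0)) :=
    (tendsto_pow_atTop_nhds_zero_of_lt_one C.2 (by exact_mod_cast hC1)).const_mul _
  rw [mul_zero] at hlim
  obtain ⟨m, hm⟩ := (hlim.eventually_lt_const hr).exists
  obtain ⟨u, hxu, hu, hum⟩ := key m
  exact absurd (hcon u hxu hu) (not_lt.2 (hum.trans hm.le))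

theorem encard_le_order_add_one (F : IFS X k) (n : ℕ) {x : X} (hx : x ∈ F.attractor) :
    {w : {w : List (Fin k) // w.length = n + 1} | x ∈ F.wordMap w.1 '' F.attractor}.encard ≤
      F.naturalFractalStructure.order + 1 := by
  have h : coveringOrderAt (F.naturalFractalStructure.piece n) x ≤
      F.naturalFractalStructure.order :=
    (le_iSup₂ (f := fun y (_ : y ∈ F.attractor) =>
      coveringOrderAt (F.naturalFractalStructure.piece n) y) x hx).trans
      (le_iSup (fun m => coveringOrder F.attractor (F.naturalFractalStructure.piece m)) n)
  exact tsub_le_iff_right.1 h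

/-- If some level of the natural fractal structure has a proper subcovering, there are points of
arbitrarily large multiplicity. -/
theorem exists_le_encard (F : IFS X k) {n : ℕ}
    {J : Set {w : List (Fin k) // w.length = n + 1}}
    (hJ : ⋃ w ∈ J, F.wordMap w.1 '' F.attractor = F.attractor) (hne : J ≠ univ) (m : ℕ) :
    ∃ N, ∃ x ∈ F.attractor, (m : ℕ∞) ≤
      {w : {w : List (Fin k) // w.length = N + 1} | x ∈ F.wordMap w.1 '' F.attractor}.encard := by
  obtain ⟨w, hw⟩ := (ne_univ_iff_exists_notMem J).1 hne
  have hsub : ∀ v : List (Fin k), F.wordMap v '' F.attractor ⊆ F.attractor := by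
    refine F.image_wordMap_subset fun i => ?_
    conv_rhs => rw [F.attractor_spec.2.2]
    exact subset_iUnion (fun i => F.f i '' F.attractor) i
  induction m with
  | zero =>
    obtain ⟨x, hx⟩ := F.attractor_spec.1
    exact ⟨0, x, hx, by simp⟩
  | succ m ih =>
    obtain ⟨N, x, hx, hm⟩ := ih
    have hxw : F.wordMap w.1 x ∈ F.attractor := hsub w.1 ⟨x, hx, rfl⟩
    -- Level `N` holds words of length `N + 1`, so concatenations have length `(n + 1) + (N + 1)`.
    refine ⟨n + 1 + N, F.wordMap w.1 x, hxw, ?_⟩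
    set S := {u : {u : List (Fin k) // u.length = N + 1} | x ∈ F.wordMap u.1 '' F.attractor}
    obtain ⟨j, hj, y, hy, hyx⟩ := mem_iUnion₂.1 (hJ.symm ▸ hxw)
    rw [← F.iUnion_image_wordMap (N + 1)] at hy
    obtain ⟨u, z, hz, rfl⟩ := mem_iUnion.1 hy
    let φ : {u : List (Fin k) // u.length = n + 1} → {u : List (Fin k) // u.length = N + 1} →
        {u : List (Fin k) // u.length = n + 1 + N + 1} :=
      fun a b => ⟨a.1 ++ b.1, by simp [a.2, b.2]; omega⟩
    have hφ : Function.Injective (φ w) := fun a b h =>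
      Subtype.ext (List.append_cancel_left (congrArg Subtype.val h))
    -- The extra word is new: its prefix `j` lies in `J`, whereas `w` does not.
    have hnot : φ j u ∉ φ w '' S := by
      rintro ⟨a, -, h⟩
      have := (List.append_inj (congrArg Subtype.val h) (w.2.trans j.2.symm)).1
      exact hw (Subtype.ext this ▸ hj)
    calc ((m + 1 : ℕ) : ℕ∞) ≤ S.encard + 1 := by push_cast; gcongr
      _ = (insert (φ j u) (φ w '' S)).encard := by
        rw [encard_insert_of_notMem hnot, hφ.encard_image]
      _ ≤ _ := by
        refine encard_le_encard (insert_subset ?_ ?_)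
        · exact ⟨z, hz, by simpa [φ, wordMap_append] using hyx⟩
        · rintro _ ⟨a, ⟨b, hb, rfl⟩, rfl⟩
          exact ⟨b, hb, by simp [φ, wordMap_append]⟩

/-- If the natural fractal structure has finite order, it is irreducible. -/
theorem isIrreducible_of_order_lt_top (F : IFS X k) (h : F.naturalFractalStructure.order < ⊤) :
    F.naturalFractalStructure.IsIrreducible := by
  refine fun n => ⟨F.naturalFractalStructure.covers n, fun J hJ => ?_⟩
  by_contra hne
  obtain ⟨M, hM⟩ := ENat.ne_top_iff_exists.1 h.ne
  -- Order `M` allows multiplicity `M + 1`, so `M + 2` is the first contradictory value.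
  obtain ⟨N, x, hx, hle⟩ := F.exists_le_encard hJ hne (M + 2)
  have := hle.trans (F.encard_le_order_add_one N hx)
  rw [← hM] at this
  have : M + 2 ≤ M + 1 := by exact_mod_cast this
  omega

end Attractor

/-! ### Packing and the open set condition -/

section NormedSpace

variable {E : Type*} [NormedAddCommGroup E] [NormedSpace ℝ E] [FiniteDimensional ℝ E] {k : ℕ}

/-- Rescaled by the inverse ratio, a similitude is an isometry; strict convexity makes it affine,
and equal finite dimensions make it onto. This is what puts full balls inside the images of `V`. -/
theorem surjective_f [StrictConvexSpace ℝ E] (F : IFS E k) (i : Fin k) :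
    Function.Surjective (F.f i) := by
  let _ : Inhabited E := ⟨0⟩
  have hr := F.ratio_pos i
  have hiso : Isometry fun x => (F.ratio i)⁻¹ • F.f i x := Isometry.of_dist_eq fun x y => by
    rw [dist_smul₀, F.dist_map, Real.norm_of_nonneg (inv_pos.2 hr).le, inv_mul_cancel_left₀ hr.ne']
  have hsurj : Function.Surjective hiso.affineIsometryOfStrictConvexSpace :=
    (hiso.affineIsometryOfStrictConvexSpace.toAffineIsometryEquiv rfl).surjective
  intro y
  obtain ⟨x, hx⟩ := hsurj ((F.ratio i)⁻¹ • y)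
  exact ⟨x, smul_right_injective E (inv_pos.2 hr).ne' hx⟩

theorem surjective_wordMap [StrictConvexSpace ℝ E] (F : IFS E k) (w : List (Fin k)) :
    Function.Surjective (F.wordMap w) := by
  induction w with
  | nil => exact Function.surjective_id
  | cons i w ih => exact (F.surjective_f i).comp ih

theorem ball_subset_image_wordMap [StrictConvexSpace ℝ E] (F : IFS E k) (w : List (Fin k)) (v : E)
    (ρ : ℝ) : Metric.ball (F.wordMap w v) (F.wordRatio w * ρ) ⊆
      F.wordMap w '' Metric.ball v ρ := by
  intro y hy
  obtain ⟨z, rfl⟩ := F.surjective_wordMap w y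
  rw [Metric.mem_ball, dist_wordMap] at hy
  exact ⟨z, lt_of_mul_lt_mul_left hy (F.wordRatio_pos w).le, rfl⟩

/-- A uniform bound, invariant under scaling, for the size of a separated family in a ball. -/
theorem exists_encard_le_of_separated (E : Type*) [NormedAddCommGroup E] [NormedSpace ℝ E]
    [FiniteDimensional ℝ E] (D : ℝ) {ε : ℝ} (hε : 0 < ε) :
    ∃ M : ℕ, ∀ (r : ℝ) (_ : 0 < r) (x : E) {ι : Type} (s : Set ι) (p : ι → E),
      (∀ i ∈ s, dist (p i) x ≤ D * r) →
      (∀ i ∈ s, ∀ j ∈ s, i ≠ j → ε * r ≤ dist (p i) (p j)) → s.encard ≤ M := by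
  have := FiniteDimensional.proper ℝ E
  obtain ⟨t, htf, ht⟩ :=
    Metric.totallyBounded_iff.1 (isCompact_closedBall (0 : E) D).totallyBounded (ε / 2)
      (half_pos hε)
  refine ⟨t.ncard, fun r hr x ι s p hD hsep => ?_⟩
  have hcov : ∀ i ∈ s, ∃ y ∈ t, dist (r⁻¹ • (p i - x)) y < ε / 2 := by
    intro i hi
    have : r⁻¹ • (p i - x) ∈ Metric.closedBall (0 : E) D := by
      rw [mem_closedBall_zero_iff, norm_smul, Real.norm_of_nonneg (inv_pos.2 hr).le,
        ← dist_eq_norm, inv_mul_le_iff₀ hr, mul_comm]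
      exact hD i hi
    simpa using ht this
  choose! q hqt hq using hcov
  rw [htf.cast_ncard_eq]
  -- After rescaling by `r⁻¹`, two points sharing a centre of the `ε / 2`-net would be closer than
  -- `ε`.
  refine encard_le_encard_of_injOn (f := q) hqt fun i hi j hj hij => ?_
  by_contra hne
  have h1 : dist (r⁻¹ • (p i - x)) (r⁻¹ • (p j - x)) < ε := by
    have h2 := hq j hj
    rw [← hij] at h2
    linarith [hq i hi, dist_triangle_right (r⁻¹ • (p i - x)) (r⁻¹ • (p j - x)) (q i)]
  rw [dist_smul₀, Real.norm_of_nonneg (inv_pos.2 hr).le, dist_sub_right, inv_mul_lt_iff₀ hr,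
    mul_comm] at h1
  exact absurd (hsep i hi j hj hne) (not_le.2 h1)

/-- Under the open set condition the natural fractal structure has finite order. -/
theorem order_lt_top_of_openSetCondition [StrictConvexSpace ℝ E] [CompleteSpace E] (F : IFS E k)
    (h : F.OpenSetCondition) : F.naturalFractalStructure.order < ⊤ := by
  obtain ⟨V, hVo, ⟨v, hv⟩, hV, hd⟩ := h
  obtain ⟨ρ, hρ, hρV⟩ := Metric.isOpen_iff.1 hVo v hv
  obtain ⟨c, hc0, hc⟩ := F.exists_ratio_lower_bound
  have hc1 : c ≤ 1 := (hc ⟨0, by have := F.two_le; omega⟩).trans (F.ratio_lt_one _).le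
  obtain ⟨D, hD⟩ := F.attractor_spec.2.1.isBounded.subset_closedBall v
  obtain ⟨M, hM⟩ := exists_encard_le_of_separated E D (mul_pos hc0 hρ)
  refine lt_of_le_of_lt (iSup_le fun n => iSup₂_le fun x _ => ?_) (ENat.natCast_lt_top M)
  refine tsub_le_self.trans ?_
  have hr : 0 < c ^ (n + 1) := pow_pos hc0 _
  have hext : ∀ w : {w : List (Fin k) // w.length = n + 1},
      x ∈ F.wordMap w.1 '' F.attractor → ∃ u, x ∈ F.wordMap (w.1 ++ u) '' F.attractor ∧
        c * c ^ (n + 1) ≤ F.wordRatio (w.1 ++ u) ∧ F.wordRatio (w.1 ++ u) ≤ c ^ (n + 1) := by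
    intro w hw
    refine F.exists_extension_wordRatio hc hr ?_ hw
    have := F.pow_le_wordRatio hc0.le hc w.1
    rw [w.2] at this
    exact (mul_le_of_le_one_left hr.le hc1).trans this
  choose! u hxu hlow hupp using hext
  refine hM _ hr x _ (fun w => F.wordMap (w.1 ++ u w) v) (fun w hw => ?_)
    fun w hw w' _ hne => ?_
  · obtain ⟨y, hy, hyx⟩ := hxu w hw
    rw [← hyx, dist_wordMap, mul_comm D, dist_comm]
    exact mul_le_mul (hupp w hw) (hD hy) dist_nonneg hr.le
  · by_contra! hlt
    -- Two images of `v` that are too close would put one of them in both images of `V`. The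
    -- extended words may differ in length, so disjointness is applied to the prefixes `w` and `w'`.
    have hmem : F.wordMap (w'.1 ++ u w') v ∈ F.wordMap (w.1 ++ u w) '' V := by
      refine image_mono hρV (F.ball_subset_image_wordMap _ v ρ ?_)
      rw [Metric.mem_ball, dist_comm]
      refine hlt.trans_le ?_
      rw [mul_right_comm]
      exact mul_le_mul_of_nonneg_right (hlow w hw) hρ.le
    have hsub : ∀ a b : List (Fin k), F.wordMap (a ++ b) '' V ⊆ F.wordMap a '' V := by
      intro a b
      rw [wordMap_append, image_comp]
      exact image_mono (F.image_wordMap_subset hV b)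
    exact disjoint_left.1
      (F.disjoint_image_wordMap hV hd (w.2.trans w'.2.symm) fun h => hne (Subtype.ext h))
      (hsub _ _ hmem) (hsub _ _ ⟨v, hv, rfl⟩)

end NormedSpace

end IFS

theorem mainTheorem6 (d k : ℕ) (F : IFS (EuclideanSpace ℝ (Fin d)) k) :
    (F.OpenSetCondition → F.naturalFractalStructure.order < ⊤) ∧
    (F.naturalFractalStructure.order < ⊤ → F.naturalFractalStructure.IsIrreducible) :=
  ⟨F.order_lt_top_of_openSetCondition, F.isIrreducible_of_order_lt_top⟩
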